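/- Let $R$ be a nonzero associative ring with identity whose only idempotents are $0$ and $1$, let $J(R)$ be its Jacobson radical, and let $n\ge 1$ be an integer. Let $M_n(R)$ be the ring of $n\times n$ matrices over $R$, and let $M_n(J(R))$ be its ideal of matrices with all entries in $J(R)$. A ring $S$ is called nil-clean if for every $a\in S$ there is an idempotent $e\in S$ such that $a-e$ is nilpotent. Then the following are equivalent: (1) $M_n(R)$ is nil-clean; (2) $R/J(R)\cong \mathbb{Z}_2$ (the ring of integers modulo $2$), and $M_n(J(R))$ is nil, i.e. every element of it is nilpotent. -/

import Mathlib

/-- An element is nil-clean if subtracting some idempotent from it leaves a nilpotent. -/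
def IsNilCleanElem {R : Type*} [Ring R] (a : R) : Prop :=
  ∃ e : R, IsIdempotentElem e ∧ IsNilpotent (a - e)

/-- A ring is nil-clean if each of its elements is nil-clean. -/
def IsNilCleanRing (R : Type*) [Ring R] : Prop :=
  ∀ a : R, IsNilCleanElem a

/-- A ring without idempotents other than `0` and `1`. -/
def HasOnlyTrivialIdempotents (R : Type*) [Ring R] : Prop :=
  ∀ e : R, IsIdempotentElem e → e = 0 ∨ e = 1

/-- An ideal is nil if each of its elements is nilpotent. -/
def IsNilIdeal {R : Type*} [Ring R] (I : Ideal R) : Prop :=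
  ∀ x ∈ I, IsNilpotent x

/-! Suppose M_n(R) is nil-clean. It is then an exchange ring, and the corner entry of an exchange
idempotent for `single i i x` is an idempotent of R, hence 0 or 1; so x or 1 - x is a unit and D =
R/J(R) is a division ring. Over D, if f is idempotent, c ≠ 0 and f + c E_ii is nilpotent, then c =
-1, which leaves only two elements. Finally M_n(J(R)) lies in the radical of M_n(R), which is nil.

Conversely, idempotents lift modulo the nil ideal M_n(J(R)), so only M_n(F_2) matters. Induction on
dimension along invariant subspaces reduces to a cyclic operator, for which an explicit idempotent
of rank at most two works. -/

theorem Ring.jacobson_eq_jacobson_bot (R : Type*) [Ring R] :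
    Ring.jacobson R = Ideal.jacobson (⊥ : Ideal R) := by
  simp [Ring.jacobson_eq_sInf_isMaximal, Ideal.jacobson]

theorem Ring.mem_jacobson_iff {R : Type*} [Ring R] {x : R} :
    x ∈ Ring.jacobson R ↔ ∀ y, ∃ z, z * y * x + z = 1 := by
  simp [Ring.jacobson_eq_jacobson_bot, Ideal.mem_jacobson_iff, sub_eq_zero]

theorem IsIdempotentElem.eq_zero_of_mem_jacobson {R : Type*} [Ring R] {e : R}
    (he : IsIdempotentElem e) (h : e ∈ Ring.jacobson R) : e = 0 := by
  -- The choice y = -1 makes 1 - e left invertible, while (1 - e) e = 0.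
  obtain ⟨z, hz⟩ := Ring.mem_jacobson_iff.1 h (-1)
  have h1 : (z * (-1) * e + z) * e = 0 := by
    rw [add_mul, mul_assoc, he.eq]; simp
  rwa [hz, one_mul] at h1

/-! ### Nil-clean rings: transfer, radical, exchange -/

namespace IsNilCleanRing

variable {R : Type*} [Ring R]

theorem of_surjective {S : Type*} [Ring S] (h : IsNilCleanRing R) (f : R →+* S)
    (hf : Function.Surjective f) : IsNilCleanRing S := by
  intro b
  obtain ⟨a, rfl⟩ := hf b
  obtain ⟨e, he, hq⟩ := h a
  exact ⟨f e, he.map f, by simpa using hq.map f⟩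

theorem of_surjective_of_nil_ker {S : Type*} [Ring S] (h : IsNilCleanRing S) (f : R →+* S)
    (hf : Function.Surjective f) (hker : ∀ x ∈ RingHom.ker f, IsNilpotent x) :
    IsNilCleanRing R := by
  intro a
  obtain ⟨e, he, k, hk⟩ := h (f a)
  obtain ⟨e', he', rfl⟩ :=
    exists_isIdempotentElem_eq_of_ker_isNilpotent f hker e (hf e) he
  refine ⟨e', he', ?_⟩
  obtain ⟨l, hl⟩ := hker ((a - e') ^ k) (by simpa [RingHom.mem_ker] using hk)
  exact ⟨k * l, by rw [pow_mul, hl]⟩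

/-- The Jacobson radical of a nil-clean ring is nil. -/
theorem isNilIdeal_jacobson (h : IsNilCleanRing R) : IsNilIdeal (Ring.jacobson R) := by
  intro a ha
  obtain ⟨e, he, hq⟩ := h a
  have hmem : e ∈ Ring.jacobson R := by
    rw [← Ideal.Quotient.eq_zero_iff_mem] at ha ⊢
    have h1 := hq.map (Ideal.Quotient.mk (Ring.jacobson R))
    rw [map_sub, ha, zero_sub, isNilpotent_neg_iff] at h1
    exact (he.map _).eq_zero_of_isNilpotent h1
  rw [he.eq_zero_of_mem_jacobson hmem, sub_zero] at hq
  exact hq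

/-- Nil-clean rings are exchange rings. -/
theorem exists_isIdempotentElem_exchange (h : IsNilCleanRing R) (a : R) :
    ∃ f s t : R, IsIdempotentElem f ∧ f = a * s ∧ 1 - f = (1 - a) * t := by
  -- Shifting by 1 turns the nilpotent part into a unit u with a = e + u; the exchange idempotent is
  -- 1 - e conjugated by u.
  obtain ⟨e, he, hq⟩ := h (a - 1)
  obtain ⟨u, hu⟩ : IsUnit (a - e) := by
    have := hq.isUnit_one_add
    rwa [show 1 + (a - 1 - e) = a - e by abel] at this
  have ha : a = e + u := by rw [hu]; abel
  have key : u * (1 - e) * (↑u⁻¹ : R) = a - (a * a - a) * (↑u⁻¹ : R) := by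
    rw [Units.mul_inv_eq_iff_eq_mul, sub_mul, Units.inv_mul_cancel_right, ha]
    simp only [mul_sub, mul_add, add_mul, he.eq]
    noncomm_ring
  refine ⟨u * (1 - e) * (↑u⁻¹ : R), 1 - (a - 1) * (↑u⁻¹ : R), 1 - a * (↑u⁻¹ : R), ?_, ?_, ?_⟩
  · have h1 := he.one_sub.eq
    unfold IsIdempotentElem
    calc _ = u * ((1 - e) * (1 - e)) * (↑u⁻¹ : R) := by simp [mul_assoc]
      _ = _ := by rw [h1]
  · rw [key]; noncomm_ring
  · rw [key]; noncomm_ring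

/-- A left multiple by `single i i x` is supported on row i, so the (i, i) entry of the exchange
idempotent is itself idempotent. -/
theorem matrix_diag_exchange {n : Type*} [Fintype n] [DecidableEq n] [Nonempty n]
    (h : IsNilCleanRing (Matrix n n R)) (x : R) :
    ∃ e s t : R, IsIdempotentElem e ∧ e = x * s ∧ 1 - e = (1 - x) * t := by
  obtain ⟨i⟩ := ‹Nonempty n›
  obtain ⟨f, s, t, hf, hs, ht⟩ := h.exists_isIdempotentElem_exchange (Matrix.single i i x)
  refine ⟨f i i, s i i, t i i, ?_, ?_, ?_⟩
  · have h1 := congrFun (congrFun hf.eq i) i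
    rw [Matrix.mul_apply, Finset.sum_eq_single i] at h1
    · exact h1
    · intro j _ hj
      have : f j i = 0 := by rw [hs, Matrix.single_mul_apply_of_ne _ _ _ _ _ hj]
      rw [this, mul_zero]
    · simp
  · nth_rw 1 [hs]; simp
  · have h1 := congrFun (congrFun ht i) i
    simpa [sub_mul] using h1

end IsNilCleanRing

/-! ### Locality of R -/

namespace HasOnlyTrivialIdempotents

variable {R : Type*} [Ring R] [Nontrivial R]

theorem mul_eq_one_symm (hR : HasOnlyTrivialIdempotents R) {x y : R} (hxy : x * y = 1) :
    y * x = 1 := by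
  have h : IsIdempotentElem (y * x) := by
    unfold IsIdempotentElem
    rw [mul_assoc, ← mul_assoc x, hxy, one_mul]
  refine (hR _ h).resolve_left fun h0 => ?_
  have : x * (y * x) * y = 1 := by rw [← mul_assoc, hxy, one_mul, hxy]
  simp [h0] at this

theorem isUnit_or_isUnit_one_sub (hR : HasOnlyTrivialIdempotents R) {n : Type*} [Fintype n]
    [DecidableEq n] [Nonempty n] (h : IsNilCleanRing (Matrix n n R)) (x : R) :
    IsUnit x ∨ IsUnit (1 - x) := by
  obtain ⟨e, s, t, he, hs, ht⟩ := h.matrix_diag_exchange x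
  rcases hR e he with rfl | rfl
  · rw [sub_zero] at ht
    exact .inr ⟨⟨_, t, ht.symm, hR.mul_eq_one_symm ht.symm⟩, rfl⟩
  · exact .inl ⟨⟨_, s, hs.symm, hR.mul_eq_one_symm hs.symm⟩, rfl⟩

/-- Outside the radical, some 1 + y x has no left inverse, so y x is a unit; the resulting left
inverse of x is two-sided. -/
theorem isUnit_of_notMem_jacobson (hR : HasOnlyTrivialIdempotents R)
    (h : ∀ x : R, IsUnit x ∨ IsUnit (1 - x)) {x : R} (hx : x ∉ Ring.jacobson R) : IsUnit x := by
  rw [Ring.mem_jacobson_iff] at hx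
  push Not at hx
  obtain ⟨y, hy⟩ := hx
  rcases h (-(y * x)) with ⟨u, hu⟩ | ⟨u, hu⟩
  · have h1 : (↑u⁻¹ * -y) * x = 1 := by
      rw [mul_assoc, neg_mul, ← hu, Units.inv_mul]
    exact ⟨⟨x, _, hR.mul_eq_one_symm h1, h1⟩, rfl⟩
  · refine absurd ?_ (hy ↑u⁻¹)
    have h1 : (↑u⁻¹ : R) * (1 - -(y * x)) = 1 := by rw [← hu, Units.inv_mul]
    rw [← h1]; noncomm_ring

end HasOnlyTrivialIdempotents

/-! ### Nil-clean matrices over a division ring -/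

open Matrix in
theorem Matrix.eq_zero_of_isNilpotent_of_vecMul_eq_smul {D n : Type*} [DivisionRing D] [Fintype n]
    [DecidableEq n] {q : Matrix n n D} (hq : IsNilpotent q) {r : D} {x : n → D}
    (h : x ᵥ* q = r • x) (hx : x ≠ 0) : r = 0 := by
  obtain ⟨k, hk⟩ := hq
  have hpow : ∀ k : ℕ, x ᵥ* q ^ k = r ^ k • x := by
    intro k
    induction k with
    | zero => simp
    | succ k ih =>
      rw [pow_succ, ← vecMul_vecMul, ih, smul_vecMul, h, smul_smul, pow_succ]
  have h1 := hpow k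
  rw [hk, vecMul_zero] at h1
  exact eq_zero_of_pow_eq_zero ((smul_eq_zero.1 h1.symm).resolve_right hx)

open Matrix in
-- A substitute for the trace, since D may be noncommutative: f has a one-dimensional row space,
-- spanned by v, and q preserves the span of v and e, where its eigenvectors are computed.
theorem Matrix.eq_neg_one_of_isNilpotent_add_single {D n : Type*} [DivisionRing D] [Fintype n]
    [DecidableEq n] {f : Matrix n n D} (hf : IsIdempotentElem f) {i : n} {c : D} (hc : c ≠ 0)
    (hq : IsNilpotent (f + single i i c)) : c = -1 := by
  set e : n → D := Pi.single i 1 with he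
  have hei : e i = 1 := by simp [he]
  have he0 : e ≠ 0 := fun h => by simp [h] at hei
  set q := f + single i i c with hqdef
  have hxq : ∀ x, x ᵥ* q = x ᵥ* f + (x i * c) • e := by
    intro x
    rw [hqdef, vecMul_add]
    congr 1
    ext j
    by_cases hj : j = i
    · subst hj; simp [vecMul, dotProduct, single, he, ite_and]
    · simp [vecMul, dotProduct, single, he, hj, Ne.symm hj]
  -- Such a row would be fixed by the nilpotent q. So coordinate i is injective on the row space of
  -- f.
  have hinj : ∀ x, x ᵥ* f = x → x i = 0 → x = 0 := by
    intro x hx hxi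
    by_contra h0
    exact one_ne_zero (eq_zero_of_isNilpotent_of_vecMul_eq_smul hq (r := 1) (x := x)
      (by rw [hxq, hx, hxi]; simp) h0)
  have hidem : ∀ x, x ᵥ* f ᵥ* f = x ᵥ* f := fun x => by rw [vecMul_vecMul, hf.eq]
  obtain ⟨v, hvf, hvi⟩ : ∃ v, v ᵥ* f = v ∧ v i = 1 := by
    by_cases hef : e ᵥ* f = 0
    · refine absurd (eq_zero_of_isNilpotent_of_vecMul_eq_smul hq (r := c) (x := e) ?_ he0) hc
      rw [hxq, hef, hei]; simp
    · have h1 : (e ᵥ* f) i ≠ 0 := fun h => hef (hinj _ (hidem e) h)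
      refine ⟨((e ᵥ* f) i)⁻¹ • (e ᵥ* f), by rw [smul_vecMul, hidem], ?_⟩
      simp [h1]
  have hxf : ∀ x, x ᵥ* f = (x ᵥ* f) i • v := by
    intro x
    rw [← sub_eq_zero]
    apply hinj
    · rw [sub_vecMul, hidem, smul_vecMul, hvf]
    · simp [hvi]
  set p := (e ᵥ* f) i with hp
  have hvq : v ᵥ* q = v + c • e := by rw [hxq, hvf, hvi, one_mul]
  have heq : e ᵥ* q = p • v + c • e := by rw [hxq, hxf, hei, one_mul]
  -- The last nonzero iterate y of v under q lies in the span of v and e and is killed by q; if p ≠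
  -- 1, its coefficients must vanish.
  have hp1 : p = 1 := by
    by_contra hp1
    have hve : e - v ≠ 0 := by
      intro h
      rw [sub_eq_zero] at h
      rw [hp, h, hvf, hvi] at hp1
      exact hp1 rfl
    classical
    have hex : ∃ k, v ᵥ* q ^ k = 0 := by
      obtain ⟨k, hk⟩ := hq
      exact ⟨k, by rw [hk, vecMul_zero]⟩
    have hv0 : v ≠ 0 := fun h => by simp [h] at hvi
    obtain ⟨j, hj⟩ : ∃ j, Nat.find hex = j + 1 := by
      refine Nat.exists_eq_succ_of_ne_zero fun h => hv0 ?_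
      have := Nat.find_spec hex
      rw [h] at this
      simpa using this
    have hy0 : v ᵥ* q ^ j ≠ 0 := Nat.find_min hex (by omega)
    have hyq : v ᵥ* q ^ j ᵥ* q = 0 := by
      rw [vecMul_vecMul, ← pow_succ, ← hj]
      exact Nat.find_spec hex
    obtain ⟨α, β, hy⟩ : ∃ α β : D, v ᵥ* q ^ j = α • v + β • e := by
      clear hj hy0 hyq
      induction j with
      | zero => exact ⟨1, 0, by simp⟩
      | succ j ih =>
        obtain ⟨α, β, h⟩ := ih
        refine ⟨α + β * p, α * c + β * c, ?_⟩
        rw [pow_succ, ← vecMul_vecMul, h, add_vecMul, smul_vecMul, smul_vecMul, hvq, heq]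
        simp only [smul_add, smul_smul, add_smul]
        abel
    rw [hy] at hyq hy0
    set y := α • v + β • e with hydef
    have hyi : y i = α + β := by simp [hydef, hvi, hei]
    have hyf : (y ᵥ* f) i = α + β * p := by
      rw [hydef, add_vecMul, smul_vecMul, smul_vecMul, hvf]; simp [hvi, hp]
    rw [hxq, hxf, hyf, hyi] at hyq
    have h1 : α + β * p + (α + β) * c = 0 := by
      simpa [hvi, hei] using congrFun hyq i
    have h2 : ((α + β) * c) • (e - v) = 0 := by
      rw [eq_neg_of_add_eq_zero_left h1] at hyq
      rw [← hyq, smul_sub, neg_smul]; abel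
    have h3 : α + β = 0 :=
      (mul_eq_zero.1 ((smul_eq_zero.1 h2).resolve_right hve)).resolve_right hc
    rw [h3, zero_mul, add_zero, eq_neg_of_add_eq_zero_left h3] at h1
    have h4 : β * (p - 1) = 0 := by rw [← h1]; noncomm_ring
    have h5 : β = 0 := (mul_eq_zero.1 h4).resolve_right (sub_ne_zero.2 hp1)
    apply hy0
    rw [hydef, eq_neg_of_add_eq_zero_left h3, h5]; simp
  have hw : (v + c • e) ᵥ* q = (1 + c) • (v + c • e) := by
    rw [add_vecMul, smul_vecMul, hvq, heq, hp1, one_smul, add_smul, one_smul]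
  have h1 : 1 + c = 0 := by
    by_cases h0 : v + c • e = 0
    · simpa [hvi, hei] using congrFun h0 i
    · exact eq_zero_of_isNilpotent_of_vecMul_eq_smul hq hw h0
  exact eq_neg_of_add_eq_zero_right h1

/-- A division ring with a nonempty nil-clean matrix ring over it has two elements. -/
theorem IsNilCleanRing.nonempty_ringEquiv_zmod_two {D n : Type*} [DivisionRing D] [Fintype n]
    [DecidableEq n] [Nonempty n] (h : IsNilCleanRing (Matrix n n D)) :
    Nonempty (D ≃+* ZMod 2) := by
  obtain ⟨i⟩ := ‹Nonempty n›
  have key : ∀ c : D, c ≠ 0 → c = -1 := by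
    intro c hc
    obtain ⟨f, hf, hq⟩ := h (Matrix.single i i (-c))
    refine Matrix.eq_neg_one_of_isNilpotent_add_single hf (i := i) hc ?_
    have h1 := hq.neg
    rwa [neg_sub, ← Matrix.single_neg, sub_neg_eq_add] at h1
  have key' : ∀ c : D, c = 0 ∨ c = 1 := by
    intro c
    by_cases hc : c = 0
    · exact .inl hc
    · exact .inr ((key c hc).trans (key 1 one_ne_zero).symm)
  classical
  let _ : Fintype D := ⟨{0, 1}, fun c => by simpa using key' c⟩
  have hcard : Fintype.card D = 2 := by
    change ({0, 1} : Finset D).card = 2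
    exact Finset.card_pair zero_ne_one
  exact ⟨(ZMod.ringEquivOfPrime D Nat.prime_two hcard).symm⟩

theorem HasOnlyTrivialIdempotents.nonempty_quotient_jacobson_ringEquiv {R : Type*} [Ring R]
    [Nontrivial R] (hR : HasOnlyTrivialIdempotents R) {n : Type*} [Fintype n] [DecidableEq n]
    [Nonempty n] (h : IsNilCleanRing (Matrix n n R)) :
    Nonempty ((R ⧸ Ring.jacobson R) ≃+* ZMod 2) := by
  have hunit : ∀ a : R ⧸ Ring.jacobson R, IsUnit a ∨ a = 0 := by
    intro a
    obtain ⟨x, rfl⟩ := Ideal.Quotient.mk_surjective a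
    by_cases hx : x ∈ Ring.jacobson R
    · exact .inr (Ideal.Quotient.eq_zero_iff_mem.2 hx)
    · exact .inl ((hR.isUnit_of_notMem_jacobson (hR.isUnit_or_isUnit_one_sub h) hx).map _)
  have : Nontrivial (R ⧸ Ring.jacobson R) :=
    Ideal.Quotient.nontrivial_iff.2 (Ring.jacobson_lt_top R).ne
  let _ : DivisionRing (R ⧸ Ring.jacobson R) := DivisionRing.ofIsUnitOrEqZero hunit
  refine IsNilCleanRing.nonempty_ringEquiv_zmod_two (n := n)
    (h.of_surjective (Ideal.Quotient.mk (Ring.jacobson R)).mapMatrix ?_)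
  intro A
  choose g hg using fun i j => Ideal.Quotient.mk_surjective (A i j)
  exact ⟨Matrix.of g, by ext i j; exact hg i j⟩

theorem IsNilCleanRing.isNilIdeal_matrix_jacobson {R n : Type*} [Ring R] [Fintype n]
    [DecidableEq n] (h : IsNilCleanRing (Matrix n n R)) :
    IsNilIdeal ((Ring.jacobson R).matrix n) := by
  intro x hx
  apply h.isNilIdeal_jacobson
  rw [Ring.jacobson_eq_jacobson_bot] at hx ⊢
  simpa using Ideal.matrix_jacobson_le (n := n) ⊥ hx

/-! ### Endomorphisms over the field with two elements -/

section EndomorphismsZModTwo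

open Module

section Field

variable {K V : Type*} [Field K] [AddCommGroup V] [Module K V]

/-- A linear section s of the quotient map gives a complement of W. With E block diagonal, T - E is
block triangular with nilpotent diagonal blocks. -/
theorem IsNilCleanElem.of_restrict_of_mapQ {T : End K V} {W : Submodule K V}
    (hW : ∀ x ∈ W, T x ∈ W) (h₁ : IsNilCleanElem (T.restrict hW : End K W))
    (h₂ : IsNilCleanElem (W.mapQ W T hW : End K (V ⧸ W))) : IsNilCleanElem T := by
  obtain ⟨E₁, hE₁, k, hk⟩ := h₁
  obtain ⟨E₂, hE₂, l, hl⟩ := h₂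
  obtain ⟨s, hs⟩ := W.mkQ.exists_rightInverse_of_surjective W.range_mkQ
  have hs' : ∀ y, W.mkQ (s y) = y := fun y => LinearMap.congr_fun hs y
  let π : V →ₗ[K] W := (LinearMap.id - s ∘ₗ W.mkQ).codRestrict W fun x => by
    refine (Submodule.Quotient.mk_eq_zero W).1 ?_
    change W.mkQ _ = 0
    simp only [LinearMap.sub_apply, LinearMap.id_apply, LinearMap.comp_apply, map_sub, hs',
      sub_self]
  have hπ : ∀ x, (π x : V) = x - s (W.mkQ x) := fun x => rfl
  have hmk : ∀ w : W, W.mkQ (w : V) = 0 := fun w => by simp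
  have hπs : ∀ y, π (s y) = 0 := fun y => Subtype.ext (by rw [hπ, hs', sub_self]; rfl)
  have hπw : ∀ w : W, π w = w := fun w => Subtype.ext (by rw [hπ, hmk]; simp)
  let E : End K V := W.subtype ∘ₗ E₁ ∘ₗ π + s ∘ₗ E₂ ∘ₗ W.mkQ
  have hE : ∀ x, E x = (E₁ (π x) : V) + s (E₂ (W.mkQ x)) := fun x => rfl
  refine ⟨E, ?_, ?_⟩
  · refine LinearMap.ext fun x => ?_
    have e1 : E₁ (E₁ (π x)) = E₁ (π x) := LinearMap.congr_fun hE₁ (π x)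
    have e2 : E₂ (E₂ (W.mkQ x)) = E₂ (W.mkQ x) := LinearMap.congr_fun hE₂ (W.mkQ x)
    rw [Module.End.mul_apply, hE (E x), hE x, map_add, map_add W.mkQ, hπs, hπw, hmk, hs', add_zero,
      zero_add, e1, e2]
  · have hN₁ : ∀ (k : ℕ) (w : W), ((T - E) ^ k) (w : V) = (((T.restrict hW - E₁) ^ k) w : W) := by
      intro k
      induction k with
      | zero => intro w; rfl
      | succ k ih =>
        intro w
        rw [pow_succ, pow_succ, Module.End.mul_apply, Module.End.mul_apply, ← ih]
        congr 1
        rw [LinearMap.sub_apply, hE, hmk, hπw, map_zero, map_zero, add_zero]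
        rfl
    have hN₂ : ∀ (l : ℕ) (x : V), W.mkQ (((T - E) ^ l) x) =
        ((W.mapQ W T hW - E₂) ^ l) (W.mkQ x) := by
      intro l
      induction l with
      | zero => intro w; rfl
      | succ l ih =>
        intro x
        rw [pow_succ, pow_succ, Module.End.mul_apply, Module.End.mul_apply, ih]
        congr 1
        rw [LinearMap.sub_apply, hE, map_sub, map_add, hmk, hs', zero_add]
        rfl
    refine ⟨k + l, LinearMap.ext fun x => ?_⟩
    have hmem : ((T - E) ^ l) x ∈ W := by
      rw [← W.ker_mkQ, LinearMap.mem_ker, hN₂, hl]; rfl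
    rw [pow_add, Module.End.mul_apply]
    have := hN₁ k ⟨_, hmem⟩
    rw [hk] at this
    exact this

/-- The iterates of a nonzero vector under an endomorphism without nontrivial invariant
subspaces are linearly independent, up to the dimension. -/
theorem linearIndependent_pow_apply_of_invariant_eq_top [FiniteDimensional K V] {T : End K V}
    (hT : ∀ W : Submodule K V, (∀ x ∈ W, T x ∈ W) → W ≠ ⊥ → W = ⊤) {v : V} (hv : v ≠ 0) {k : ℕ}
    (hk : k ≤ finrank K V) : LinearIndependent K fun i : Fin k => (T ^ (i : ℕ)) v := by
  induction k with
  | zero => exact linearIndependent_empty_type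
  | succ k ih =>
    rw [linearIndependent_finSucc']
    refine ⟨ih (by omega), fun hmem => ?_⟩
    have hinit : (Fin.init fun i : Fin (k + 1) => (T ^ (i : ℕ)) v) =
      fun i : Fin k => (T ^ (i : ℕ)) v := rfl
    rw [hinit] at hmem
    set W := Submodule.span K (Set.range fun i : Fin k => (T ^ (i : ℕ)) v) with hWdef
    have hpow : ∀ j ≤ k, (T ^ j) v ∈ W := by
      intro j hj
      rcases hj.lt_or_eq with hj | rfl
      · exact Submodule.subset_span ⟨⟨j, hj⟩, rfl⟩
      · simpa using hmem
    have hinv : ∀ x ∈ W, T x ∈ W := by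
      intro x hx
      suffices W ≤ W.comap T from this hx
      rw [hWdef, Submodule.span_le]
      rintro _ ⟨i, rfl⟩
      change T ((T ^ (i : ℕ)) v) ∈ W
      rw [← Module.End.mul_apply, ← pow_succ']
      exact hpow _ i.2
    have htop := hT W hinv fun h => hv (by
      have := hpow 0 (Nat.zero_le _)
      rwa [h, Submodule.mem_bot] at this)
    have h1 := finrank_range_le_card (R := K) fun i : Fin k => (T ^ (i : ℕ)) v
    rw [Set.finrank, ← hWdef, htop, finrank_top, Fintype.card_fin] at h1
    omega

end Field

theorem Module.End.isNilpotent_of_span_eq_top {K V ι : Type*} [Field K] [AddCommGroup V]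
    [Module K V] (N : End K V) {s : ι → V} (hs : Submodule.span K (Set.range s) = ⊤) (m : ℕ)
    (h : ∀ i, (N ^ m) (s i) = 0) : IsNilpotent N := by
  refine ⟨m, LinearMap.ext_on hs ?_⟩
  rintro _ ⟨i, rfl⟩
  simpa using h i

/-- An endomorphism over the field with two elements is nil-clean if the iterates of some vector
form a basis. -/
theorem isNilCleanElem_of_basis_pow_apply {V : Type*} [AddCommGroup V]
    [Module (ZMod 2) V] {n : ℕ} (T : End (ZMod 2) V) (v : V)
    (b : Basis (Fin (n + 1)) (ZMod 2) V) (hb : ∀ i, b i = (T ^ (i : ℕ)) v) :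
    IsNilCleanElem T := by
  have hadd : ∀ x : V, x + x = 0 := fun x => by
    rw [← two_smul (ZMod 2) x, show (2 : ZMod 2) = 0 from rfl, zero_smul]
  have hcoord : ∀ (i : Fin (n + 1)) (j : ℕ), j < n + 1 →
      b.coord i ((T ^ j) v) = if j = i then 1 else 0 := by
    intro i j hj
    have := hb ⟨j, hj⟩
    simp only at this
    rw [← this, Basis.coord_apply, Basis.repr_self, Finsupp.single_apply]
    simp [Fin.ext_iff]
  have hT : ∀ j, T ((T ^ j) v) = (T ^ (j + 1)) v := fun j => by
    rw [pow_succ', Module.End.mul_apply]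
  have hbit : ∀ c : ZMod 2, c = 0 ∨ c = 1 := by decide
  have hnil : ∀ (N : End (ZMod 2) V) (m : ℕ), (∀ j < n + 1, (N ^ m) ((T ^ j) v) = 0) →
      IsNilpotent N := fun N m h =>
    N.isNilpotent_of_span_eq_top b.span_eq m fun i => by rw [hb]; exact h i i.2
  -- This coordinate is the trace of T, hence the parity of the rank of any suitable idempotent.
  rcases hbit (b.coord (Fin.last n) ((T ^ (n + 1)) v)) with htr | htr
  · match n with
    | 0 =>
      have hTv : (T ^ 1) v = 0 := by
        rw [← b.sum_repr ((T ^ 1) v)]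
        have h1 : b.repr ((T ^ 1) v) 0 = 0 := htr
        rw [Fin.sum_univ_one, h1, zero_smul]
      exact ⟨0, .zero, hnil _ 1 fun j hj => by
        obtain rfl : j = 0 := by omega
        simpa using hTv⟩
    | 1 =>
      have hTv : (T ^ 2) v = b.coord 0 ((T ^ 2) v) • v := by
        conv_lhs => rw [← b.sum_repr ((T ^ 2) v)]
        have h1 : b.repr ((T ^ 2) v) 1 = 0 := htr
        rw [Fin.sum_univ_two, h1, hb 0]
        simp
      rcases hbit (b.coord 0 ((T ^ 2) v)) with h0 | h0
      · rw [h0, zero_smul] at hTv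
        refine ⟨0, .zero, hnil _ 2 fun j hj => ?_⟩
        rw [sub_zero, ← Module.End.mul_apply, ← pow_add, add_comm, pow_add, Module.End.mul_apply,
          hTv, map_zero]
      · rw [h0, one_smul] at hTv
        have hTT : ∀ j, ((T - 1 : End (ZMod 2) V) ^ 2) ((T ^ j) v) = 0 := by
          intro j
          have h2 : (T ^ (j + 2)) v = (T ^ j) v := by
            rw [pow_add, Module.End.mul_apply, hTv]
          rw [pow_two, Module.End.mul_apply]
          simp only [LinearMap.sub_apply, Module.End.one_apply, map_sub, hT, h2]
          rw [show ∀ x y : V, x - y - (y - x) = (x + x) - (y + y) from fun x y => by abel,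
            hadd, hadd, sub_zero]
        exact ⟨1, .one, hnil _ 2 fun j _ => hTT j⟩
    | m + 2 =>
      set φ := b.coord ⟨m + 1, by omega⟩ with hφ
      set ψ := b.coord (Fin.last (m + 2)) with hψ
      have hφT : ∀ j < m + 3, φ ((T ^ j) v) = if j = m + 1 then 1 else 0 :=
        fun j hj => hcoord _ j hj
      have hψT : ∀ j < m + 3, ψ ((T ^ j) v) = if j = m + 2 then 1 else 0 :=
        fun j hj => hcoord _ j hj
      have htr' : ψ ((T ^ (m + 3)) v) = 0 := htr
      -- E will send T^(m+1) v to a and T^(m+2) v to d, and kill the earlier basis vectors. The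
      -- value of d is forced by (T - E)^(m+3) v = 0, and s is chosen so that φ d = 0, which makes E
      -- fix a and d.
      set s := φ ((T ^ (m + 3)) v) + 1 with hs
      set a := (T ^ (m + 1)) v + s • (T ^ m) v with ha
      have hφa : φ a = 1 := by simp [ha, hφT]
      have hψa : ψ a = 0 := by simp [ha, hψT]
      set d := (T ^ (m + 3)) v - (T ^ (m + 2)) v - s • (T ^ (m + 1)) v + a with hd
      have hφd : φ d = 0 := by
        simp only [hd, map_add, map_sub, map_smul, hφa, hφT (m + 2) (by omega),
          hφT (m + 1) (by omega), hs]
        simp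
        rfl
      have hψd : ψ d = 1 := by
        simp only [hd, map_add, map_sub, map_smul, htr', hψa, hψT (m + 2) (by omega),
          hψT (m + 1) (by omega)]
        simp
      let E : End (ZMod 2) V := φ.smulRight a + ψ.smulRight d
      have hE : ∀ x, E x = φ x • a + ψ x • d := fun x => rfl
      refine ⟨E, LinearMap.ext fun x => ?_, ?_⟩
      · rw [Module.End.mul_apply, hE (E x), hE x]
        simp [hφa, hψa, hφd, hψd]
      · have hN : ∀ j < m + 1, (T - E) ((T ^ j) v) = (T ^ (j + 1)) v := by
          intro j hj
          rw [LinearMap.sub_apply, hE, hφT _ (by omega), hψT _ (by omega), hT,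
            if_neg (by omega), if_neg (by omega)]
          simp
        have hN₁ : (T - E) ((T ^ (m + 1)) v) = (T ^ (m + 2)) v - a := by
          rw [LinearMap.sub_apply, hE, hφT _ (by omega), hψT _ (by omega), hT]
          simp
        have hN₂ : (T - E) ((T ^ (m + 2)) v) = (T ^ (m + 3)) v - d := by
          rw [LinearMap.sub_apply, hE, hφT _ (by omega), hψT _ (by omega), hT]
          simp
        have hpow : ∀ j ≤ m + 1, ((T - E) ^ j) v = (T ^ j) v := by
          intro j
          induction j with
          | zero => simp
          | succ j ih =>
            intro hj
            rw [pow_succ', Module.End.mul_apply, ih (by omega), hN j (by omega)]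
        have hc : ((T - E) ^ (m + 2)) v = (T ^ (m + 2)) v - a := by
          rw [pow_succ', Module.End.mul_apply, hpow _ le_rfl, hN₁]
        have hlast : ((T - E) ^ (m + 3)) v = 0 := by
          rw [pow_succ', Module.End.mul_apply, hc, map_sub, hN₂, ha, map_add, map_smul, hN₁,
            hN m (by omega), hd, ha]
          abel
        have hkill : ∀ j, ((T - E) ^ (m + 3)) (((T - E) ^ j) v) = 0 := fun j => by
          rw [← Module.End.mul_apply, ← pow_add, add_comm, pow_add, Module.End.mul_apply, hlast,
            map_zero]
        refine hnil _ (m + 3) fun j hj => ?_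
        by_cases hj' : j ≤ m + 1
        · rw [← hpow j hj', hkill]
        · obtain rfl : j = m + 2 := by omega
          rw [← sub_add_cancel ((T ^ (m + 2)) v) a, ← hc, ha, ← hpow (m + 1) le_rfl,
            ← hpow m (by omega), map_add, map_add, map_smul, hkill, hkill, hkill]
          simp
  -- Trace 1 makes this rank-one map idempotent. It agrees with T on the last basis vector, so T - E
  -- is a nilpotent shift.
  · let E : End (ZMod 2) V := (b.coord (Fin.last n)).smulRight ((T ^ (n + 1)) v)
    have hE : ∀ x, E x = b.coord (Fin.last n) x • (T ^ (n + 1)) v := fun x => rfl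
    refine ⟨E, LinearMap.ext fun x => ?_, ?_⟩
    · rw [Module.End.mul_apply, hE (E x), hE x, map_smul, htr, smul_eq_mul, mul_one]
    · have hN : ∀ j < n, (T - E) ((T ^ j) v) = (T ^ (j + 1)) v := by
        intro j hj
        rw [LinearMap.sub_apply, hE, hcoord _ _ (by omega), hT]
        simp [hj.ne]
      have hpow : ∀ j ≤ n, ((T - E) ^ j) v = (T ^ j) v := by
        intro j
        induction j with
        | zero => simp
        | succ j ih =>
          intro hj
          rw [pow_succ', Module.End.mul_apply, ih (by omega), hN j (by omega)]
      have hlast : ((T - E) ^ (n + 1)) v = 0 := by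
        rw [pow_succ', Module.End.mul_apply, hpow n le_rfl, LinearMap.sub_apply, hE,
          hcoord _ _ (by omega), hT]
        simp
      refine hnil _ (n + 1) fun j hj => ?_
      rw [← hpow j (by omega), ← Module.End.mul_apply, ← pow_add, add_comm, pow_add,
        Module.End.mul_apply, hlast, map_zero]

theorem isNilCleanRing_end_zmod_two (V : Type*) [AddCommGroup V] [Module (ZMod 2) V]
    [FiniteDimensional (ZMod 2) V] : IsNilCleanRing (End (ZMod 2) V) := by
  induction h : finrank (ZMod 2) V using Nat.strong_induction_on generalizing V with
  | _ d ih =>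
  intro T
  by_cases hT : ∀ W : Submodule (ZMod 2) V, (∀ x ∈ W, T x ∈ W) → W ≠ ⊥ → W = ⊤
  · rcases subsingleton_or_nontrivial V with hV | hV
    · exact ⟨0, .zero, 1, Subsingleton.elim _ _⟩
    · obtain ⟨v, hv⟩ := exists_ne (0 : V)
      obtain ⟨n, hn⟩ := Nat.exists_eq_succ_of_ne_zero (finrank_pos (R := ZMod 2) (M := V)).ne'
      have hli := linearIndependent_pow_apply_of_invariant_eq_top hT hv hn.ge
      exact isNilCleanElem_of_basis_pow_apply T v
        (basisOfLinearIndependentOfCardEqFinrank hli (by simp [hn])) fun i => by simp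
  · push Not at hT
    obtain ⟨W, hW, hbot, htop⟩ := hT
    refine .of_restrict_of_mapQ hW (ih _ ?_ W rfl _) (ih _ ?_ (V ⧸ W) rfl _)
    · rw [← h]
      exact Submodule.finrank_lt htop
    · have h1 := W.finrank_quotient_add_finrank
      have h2 : 0 < finrank (ZMod 2) W :=
        Nat.pos_of_ne_zero fun h0 => hbot (Submodule.finrank_eq_zero.1 h0)
      omega

end EndomorphismsZModTwo

/-! ### Back to matrices, and the equivalence -/

theorem isNilCleanRing_matrix_zmod_two (n : Type*) [Fintype n] [DecidableEq n] :
    IsNilCleanRing (Matrix n n (ZMod 2)) :=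
  (isNilCleanRing_end_zmod_two (n → ZMod 2)).of_surjective
    (Matrix.toLinAlgEquiv' (R := ZMod 2) (n := n)).symm.toRingEquiv.toRingHom
    (Matrix.toLinAlgEquiv' (R := ZMod 2) (n := n)).symm.surjective

theorem isNilCleanRing_matrix_of_quotient_jacobson {R n : Type*} [Ring R] [Fintype n]
    [DecidableEq n] (e : (R ⧸ Ring.jacobson R) ≃+* ZMod 2)
    (h : IsNilIdeal ((Ring.jacobson R).matrix n)) : IsNilCleanRing (Matrix n n R) := by
  let g : R →+* ZMod 2 := e.toRingHom.comp (Ideal.Quotient.mk (Ring.jacobson R))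
  have hg : Function.Surjective g := e.surjective.comp Ideal.Quotient.mk_surjective
  refine (isNilCleanRing_matrix_zmod_two n).of_surjective_of_nil_ker g.mapMatrix ?_ ?_
  · intro A
    choose B hB using fun i j => hg (A i j)
    exact ⟨Matrix.of B, by ext i j; exact hB i j⟩
  · intro x hx
    refine h x fun i j => ?_
    have h1 : e (Ideal.Quotient.mk (Ring.jacobson R) (x i j)) = 0 := congrFun (congrFun hx i) j
    rwa [map_eq_zero_iff e e.injective, Ideal.Quotient.eq_zero_iff_mem] at h1

theorem lemma2p5 {R : Type*} [Ring R] [Nontrivial R] (hR : HasOnlyTrivialIdempotents R)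
    (n : ℕ) (hn : 1 ≤ n) :
    IsNilCleanRing (Matrix (Fin n) (Fin n) R) ↔
      Nonempty ((R ⧸ Ring.jacobson R) ≃+* ZMod 2) ∧
        IsNilIdeal ((Ring.jacobson R).matrix (Fin n)) := by
  have : Nonempty (Fin n) := ⟨⟨0, hn⟩⟩
  constructor
  · exact fun h => ⟨hR.nonempty_quotient_jacobson_ringEquiv h, h.isNilIdeal_matrix_jacobson⟩
  · rintro ⟨⟨e⟩, h⟩
    exact isNilCleanRing_matrix_of_quotient_jacobson e h
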